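/- Let $D$ be a knot diagram on the sphere with at least one crossing, and let $\gamma$ be an arc of $D$ that leaves a crossing $u$, returns to $u$ along the transverse strand, has no self-crossing other than $u$, and meets either only overcrossings or only undercrossings apart from $u$. The loop formed by $\gamma$ divides the sphere into two sides; let $R$ be the closed disc bounded by the loop on the side that does not contain the other two edges at $u$. The part of $D$ consisting of the loop and of everything inside $R$ is called a loop-tangle diagram. Its faces are the regions of $D$ contained in $R$; a triangle, quadrilateral or pentagon is a face in $R$ with $3$, $4$ or $5$ sides respectively. Two faces share an edge if the edge has one of them on each of its sides. Call the loop-tangle diagram minimal if at least one of the following holds: - no face in $R$ has one or two sides; or - $D$ is ascending from some base point $b$ outside $R$ (traversing $D$ from $b$ in a suitable direction, every crossing is met first as an undercrossing and then as an overcrossing), and no Reidemeister move of type I or II that removes crossings can be performed at a face in $R$. Then every minimal loop-tangle diagram contains at least one of the following: - a triangle at least one of whose sides is an edge of the loop; - two distinct triangles sharing an edge; - a quadrilateral sharing at least one edge with a triangle; - a pentagon at least four of whose edges are shared with triangles. -/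

import Mathlib

/-- A four-valent graph drawn on an oriented closed surface, as a combinatorial map on a type `δ`
of darts (oriented edges; a dart is attached to the vertex at its tail). -/
structure FourValentMap (δ : Type*) where
  /-- the next dart, counterclockwise, around the vertex at the tail -/
  rot : Equiv.Perm δ
  /-- the same edge with the opposite direction -/
  opp : Equiv.Perm δ
  opp_opp : ∀ d, opp (opp d) = d
  opp_ne : ∀ d, opp d ≠ d
  rot_four : ∀ d, rot (rot (rot (rot d))) = d
  rot_rot_ne : ∀ d, rot (rot d) ≠ d

namespace FourValentMap

variable {δ : Type*} (M : FourValentMap δ)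

/-- Vertices are the orbits of `rot`. -/
def Vertex : Type _ := Quotient (Equiv.Perm.SameCycle.setoid M.rot)

/-- Edges are the orbits of `opp`. -/
def Edge : Type _ := Quotient (Equiv.Perm.SameCycle.setoid M.opp)

/-- Walk along `d` with a face on the left; `faceNext d` is the next dart on the boundary of that
face: at the head of `d`, the first dart clockwise from `opp d`. -/
def faceNext : Equiv.Perm δ := M.opp.trans M.rot.symm

/-- Faces are the orbits of `faceNext`. -/
def Face : Type _ := Quotient (Equiv.Perm.SameCycle.setoid M.faceNext)

/-- The vertex at the tail of a dart. -/
def vertex (d : δ) : M.Vertex := Quotient.mk (Equiv.Perm.SameCycle.setoid M.rot) d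

/-- The face on the left of a dart. The face on its right is `M.face (M.opp d)`. -/
def face (d : δ) : M.Face := Quotient.mk (Equiv.Perm.SameCycle.setoid M.faceNext) d

/-- The number of sides of a face. -/
noncomputable def sides (f : M.Face) : ℕ := Nat.card {d : δ // M.face d = f}

/-- Walk along `d` and go straight on through the crossing at its head. -/
def straight : Equiv.Perm δ := M.opp.trans (M.rot.trans M.rot)

/-- The drawing is a single closed curve that crosses itself at the vertices: going straight on
along any edge, one meets every edge, in one of its two directions. In particular the graph is
connected. -/
def IsSingleCurve : Prop :=
  ∀ d e, M.straight.SameCycle d e ∨ M.straight.SameCycle d (M.opp e)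

/-- The surface on which the (connected) graph is drawn is a sphere: its Euler characteristic
is two. -/
def IsPlanar : Prop := Nat.card M.Vertex + Nat.card M.Face = Nat.card M.Edge + 2

end FourValentMap

/-- A knot diagram on the sphere with at least one crossing. -/
structure KnotDiagram (δ : Type*) extends FourValentMap δ where
  isSingleCurve : toFourValentMap.IsSingleCurve
  isPlanar : toFourValentMap.IsPlanar
  /-- `isOver d`: the strand of `d` is the over-strand at the crossing at the tail of `d` -/
  isOver : δ → Prop
  isOver_rot : ∀ d, isOver (rot d) ↔ ¬ isOver d

namespace KnotDiagram

variable {δ : Type*} (D : KnotDiagram δ)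

/-- The diagram is ascending from a point of the edge of `b`, when it is traversed in the
direction of `b`: every crossing is met first as an undercrossing and then as an overcrossing.
The successive crossings are left along `straight b`, `straight² b`, …, and after as many
crossings as there are edges one is back on the edge of `b`.
(Descending from `b` is the same as ascending from `opp b`.) -/
def AscendingFrom (b : δ) : Prop :=
  ∀ i j : ℕ, 1 ≤ i → i < j → j ≤ Nat.card D.Edge →
    D.vertex ((D.straight ^ i) b) = D.vertex ((D.straight ^ j) b) →
      ¬ D.isOver ((D.straight ^ i) b) ∧ D.isOver ((D.straight ^ j) b)

/-- A loop-tangle in `D`, given by its loop: the arc that leaves a crossing `u` along `start` and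
runs straight on through `len` edges until it returns to `u`. -/
structure LoopTangle where
  start : δ
  len : ℕ
  len_pos : 0 < len
  /-- the arc comes back to `u` and crosses itself there -/
  crosses_itself : (D.straight ^ len) start = D.rot start ∨
    (D.straight ^ len) start = D.rot.symm start
  /-- it has no other self-crossing -/
  simple : ∀ i j : ℕ, i < len → j < len →
    D.vertex ((D.straight ^ i) start) = D.vertex ((D.straight ^ j) start) → i = j
  /-- apart from `u`, it meets only overcrossings or only undercrossings -/
  one_sided : (∀ i : ℕ, 0 < i → i < len → D.isOver ((D.straight ^ i) start)) ∨
    (∀ i : ℕ, 0 < i → i < len → ¬ D.isOver ((D.straight ^ i) start))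

namespace LoopTangle

variable {D}
variable (L : D.LoopTangle)

/-- The edge of `d` is one of the edges of the loop. -/
def OnLoop (d : δ) : Prop :=
  ∃ i < L.len, d = (D.straight ^ i) L.start ∨ D.opp d = (D.straight ^ i) L.start

/-- `d` is one of the two darts at `u` along which the loop leaves and enters `u`. -/
def IsEnd (d : δ) : Prop :=
  d = L.start ∨ D.opp d = (D.straight ^ (L.len - 1)) L.start

/-- The face on the left of a dart lies in the disc bounded by the loop. The loop cuts the sphere
into two sides. The other two edges at `u` lie on the same side, as the two ends of the loop are
neighbours around `u`; the disc is the side that does not contain them, so it is the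
side that contains the corner between the two ends of the loop. The faces of the disc
are those reached from that corner without passing over an edge of the loop. -/
inductive LeftInDisc : δ → Prop
  | corner (d : δ) : L.IsEnd d → L.IsEnd (D.rot d) → LeftInDisc d
  | around (d : δ) : LeftInDisc d → LeftInDisc (D.faceNext d)
  | across (d : δ) : LeftInDisc d → ¬ L.OnLoop d → LeftInDisc (D.opp d)

/-- The set of faces in the disc bounded by the loop. -/
def disc : Set D.Face := {f | ∃ d, L.LeftInDisc d ∧ D.face d = f}

/-- A crossing-removing Reidemeister I move is available at a face with one side. -/
def RemovableMonogon (f : D.Face) : Prop := D.sides f = 1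

/-- A crossing-removing Reidemeister II move is available at a face with two sides: one of the
two sides passes over at both of its ends or under at both of its ends (so the other side does
the opposite). -/
def RemovableBigon (f : D.Face) : Prop :=
  D.sides f = 2 ∧ ∃ d, D.face d = f ∧ (D.isOver d ↔ D.isOver (D.opp d))

/-- Minimality in terms of Reidemeister moves: the diagram is ascending from a point that lies
outside the closed disc, and no Reidemeister I or II move that removes crossings is available
in the disc. -/
def MinimalAscending : Prop :=
  (∃ b, D.AscendingFrom b ∧ D.face b ∉ L.disc ∧ D.face (D.opp b) ∉ L.disc) ∧
    ∀ f ∈ L.disc, ¬ RemovableMonogon f ∧ ¬ RemovableBigon f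

/-- Minimality in terms of the underlying graph: no face of the disc has one or two sides. -/
def MinimalGraph : Prop := ∀ f ∈ L.disc, D.sides f ≠ 1 ∧ D.sides f ≠ 2

/-- A face of the disc with three sides. -/
def IsTriangle (f : D.Face) : Prop := f ∈ L.disc ∧ D.sides f = 3

/-- A face of the disc with four sides. -/
def IsQuadrilateral (f : D.Face) : Prop := f ∈ L.disc ∧ D.sides f = 4

/-- A face of the disc with five sides. -/
def IsPentagon (f : D.Face) : Prop := f ∈ L.disc ∧ D.sides f = 5

/-- The sides of `f` along which it borders a triangle of the disc. As these are used for faces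
`f` that are not triangles, distinct sides belong to distinct edges. -/
noncomputable def numTriangleEdges (f : D.Face) : ℕ :=
  Nat.card {d : δ // D.face d = f ∧ L.IsTriangle (D.face (D.opp d))}

end LoopTangle

end KnotDiagram

/-! The proof is a discharging argument. Give a face with `n` sides the charge `4 - n`. By
Gauss–Bonnet, the faces of a disc bounded by a loop with a single corner have total charge at least
3 (`SimpleLoop.exists_disc`). If there are no monogons and bigons, only triangles have positive
charge. Let each triangle send 1/3 across each of its sides. When none of the four configurations
occurs, each third stays in the disc and arrives at a face with at least five sides; a pentagon
receives at most three thirds, and a face with `n ≥ 6` sides at most `n / 3 ≤ n - 4`. Hence no face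
ends with positive charge, a contradiction (`MinimalGraph.exists_configuration`).

The topology is linear algebra modulo 2. Connectedness and Euler characteristic 2 make the first
homology vanish (`exists_boundary_eq`). Hence the loop bounds a set of faces, which separates its
two sides (`exists_two_coloring`); the same vanishing, restricted to the disc, gives V - E + F ≥ 1
there, and counting darts turns this into the bound on the charge.

The ascending case reduces to the graph case (`MinimalAscending.minimalGraph`): when the base point
is outside the disc, the side of a bigon that is traversed first is under at both ends, so the bigon
is removable. -/

namespace FourValentMap

/-! ### Vertices, edges and faces as orbits of darts; connectedness -/

variable {δ : Type*} (M : FourValentMap δ)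

/-- The edge of a dart. -/
def edge (d : δ) : M.Edge := Quotient.mk (Equiv.Perm.SameCycle.setoid M.opp) d

instance [Finite δ] : Finite M.Vertex := Quotient.finite _
instance [Finite δ] : Finite M.Edge := Quotient.finite _
instance [Finite δ] : Finite M.Face := Quotient.finite _

theorem vertex_surjective : Function.Surjective M.vertex := Quotient.mk_surjective
theorem edge_surjective : Function.Surjective M.edge := Quotient.mk_surjective
theorem face_surjective : Function.Surjective M.face := Quotient.mk_surjective

theorem vertex_eq_iff_sameCycle {d e : δ} : M.vertex d = M.vertex e ↔ M.rot.SameCycle d e :=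
  Quotient.eq (r := Equiv.Perm.SameCycle.setoid M.rot)
theorem edge_eq_iff_sameCycle {d e : δ} : M.edge d = M.edge e ↔ M.opp.SameCycle d e :=
  Quotient.eq (r := Equiv.Perm.SameCycle.setoid M.opp)
theorem face_eq_iff {d e : δ} : M.face d = M.face e ↔ M.faceNext.SameCycle d e :=
  Quotient.eq (r := Equiv.Perm.SameCycle.setoid M.faceNext)

theorem opp_symm : M.opp.symm = M.opp := by
  ext d; rw [Equiv.symm_apply_eq, M.opp_opp]

theorem rot_symm_apply (d : δ) : M.rot.symm d = M.rot (M.rot (M.rot d)) := by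
  rw [Equiv.symm_apply_eq, M.rot_four]

theorem rot_ne (d : δ) : M.rot d ≠ d := fun h => M.rot_rot_ne d (by rw [h, h])

theorem rot_rot_rot_ne (d : δ) : M.rot (M.rot (M.rot d)) ≠ d := fun h =>
  M.rot_ne d (by have := M.rot_four d; rwa [h] at this)

theorem faceNext_apply (d : δ) : M.faceNext d = M.rot (M.rot (M.rot (M.opp d))) := by
  simp [faceNext, rot_symm_apply]

theorem straight_apply (d : δ) : M.straight d = M.rot (M.rot (M.opp d)) := rfl

theorem opp_eq_rot_rot_straight (d : δ) : M.opp d = M.rot (M.rot (M.straight d)) := by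
  rw [straight_apply, rot_four]

theorem vertex_rot (d : δ) : M.vertex (M.rot d) = M.vertex d :=
  M.vertex_eq_iff_sameCycle.2 (Equiv.Perm.sameCycle_apply_left.2 (.refl _ _))

theorem face_faceNext (d : δ) : M.face (M.faceNext d) = M.face d :=
  M.face_eq_iff.2 (Equiv.Perm.sameCycle_apply_left.2 (.refl _ _))

theorem edge_opp (d : δ) : M.edge (M.opp d) = M.edge d :=
  M.edge_eq_iff_sameCycle.2 (Equiv.Perm.sameCycle_apply_left.2 (.refl _ _))

theorem vertex_opp (d : δ) : M.vertex (M.opp d) = M.vertex (M.straight d) := by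
  rw [straight_apply, vertex_rot, vertex_rot]

/-- The corner between `d` and `rot d` lies to the left of `d` and to the right of `rot d`. So darts
also index corners, and crossing `rot d` passes from one corner at the vertex to the next. -/
theorem face_rot (d : δ) : M.face (M.opp (M.rot d)) = M.face d := by
  rw [← face_faceNext, faceNext_apply, M.opp_opp, M.rot_four]

theorem vertex_eq_iff {d e : δ} : M.vertex e = M.vertex d ↔
    e = d ∨ e = M.rot d ∨ e = M.rot (M.rot d) ∨ e = M.rot (M.rot (M.rot d)) := by
  constructor
  · intro h
    obtain ⟨k, rfl⟩ := M.vertex_eq_iff_sameCycle.1 h.symm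
    clear h
    induction k using Int.induction_on with
    | zero => simp
    | succ k ih =>
      rw [add_comm, zpow_add, zpow_one, Equiv.Perm.mul_apply]
      rcases ih with h | h | h | h <;> rw [h] <;> simp [M.rot_four]
    | pred k ih =>
      rw [sub_eq_add_neg, add_comm, zpow_add, zpow_neg_one, Equiv.Perm.mul_apply,
        Equiv.Perm.inv_def, M.rot_symm_apply]
      rcases ih with h | h | h | h <;> rw [h] <;> simp [M.rot_four]
  · rintro (rfl | rfl | rfl | rfl) <;> simp [vertex_rot]

theorem edge_eq_iff {d e : δ} : M.edge e = M.edge d ↔ e = d ∨ e = M.opp d := by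
  constructor
  · intro h
    obtain ⟨k, rfl⟩ := M.edge_eq_iff_sameCycle.1 h.symm
    clear h
    induction k using Int.induction_on with
    | zero => simp
    | succ k ih =>
      rw [add_comm, zpow_add, zpow_one, Equiv.Perm.mul_apply]
      rcases ih with h | h <;> rw [h] <;> simp [M.opp_opp]
    | pred k ih =>
      rw [sub_eq_add_neg, add_comm, zpow_add, zpow_neg_one, Equiv.Perm.mul_apply,
        Equiv.Perm.inv_def, M.opp_symm]
      rcases ih with h | h <;> rw [h] <;> simp [M.opp_opp]
  · rintro (rfl | rfl) <;> simp [edge_opp]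

section Fibers

open scoped Classical in
theorem filter_vertex_eq [Fintype δ] (d : δ) :
    (Finset.univ.filter fun e => M.vertex e = M.vertex d) =
      {d, M.rot d, M.rot (M.rot d), M.rot (M.rot (M.rot d))} := by
  ext e; simp [M.vertex_eq_iff]

open scoped Classical in
theorem filter_edge_eq [Fintype δ] (d : δ) :
    (Finset.univ.filter fun e => M.edge e = M.edge d) = {d, M.opp d} := by
  ext e; simp [M.edge_eq_iff]

open scoped Classical in
theorem sum_vertex_fiber [Fintype δ] {R : Type*} [AddCommMonoid R] (φ : δ → R) (d : δ) :
    ∑ e with M.vertex e = M.vertex d, φ e =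
      φ d + (φ (M.rot d) + (φ (M.rot (M.rot d)) + φ (M.rot (M.rot (M.rot d))))) := by
  have h1 := M.rot_ne
  have h2 := M.rot_rot_ne
  have h3 := M.rot_rot_rot_ne
  rw [filter_vertex_eq, Finset.sum_insert, Finset.sum_insert, Finset.sum_pair]
  · exact (h1 _).symm
  · simp [(h1 _).symm, (h2 _).symm]
  · simp [(h1 _).symm, (h2 _).symm, (h3 _).symm]

open scoped Classical in
theorem sum_edge_fiber [Fintype δ] {R : Type*} [AddCommMonoid R] (φ : δ → R) (d : δ) :
    ∑ e with M.edge e = M.edge d, φ e = φ d + φ (M.opp d) := by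
  rw [filter_edge_eq, Finset.sum_pair (M.opp_ne d).symm]

open scoped Classical in
theorem four_mul_card [Fintype δ] (U : Finset M.Vertex) :
    4 * U.card = (Finset.univ.filter fun d => M.vertex d ∈ U).card := by
  rw [Finset.card_eq_sum_card_fiberwise (f := M.vertex) (t := U) (by intro d; simp),
    Finset.sum_const_nat (m := 4), mul_comm]
  intro v hv
  obtain ⟨d, rfl⟩ := M.vertex_surjective v
  rw [Finset.filter_filter, Finset.card_eq_sum_ones]
  rw [Finset.filter_congr (q := fun e => M.vertex e = M.vertex d), sum_vertex_fiber]
  · rfl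
  rintro e -
  exact ⟨fun h => h.2, fun h => ⟨h ▸ hv, h⟩⟩

open scoped Classical in
theorem two_mul_card [Fintype δ] (U : Finset M.Edge) :
    2 * U.card = (Finset.univ.filter fun d => M.edge d ∈ U).card := by
  rw [Finset.card_eq_sum_card_fiberwise (f := M.edge) (t := U) (by intro d; simp),
    Finset.sum_const_nat (m := 2), mul_comm]
  intro v hv
  obtain ⟨d, rfl⟩ := M.edge_surjective v
  rw [Finset.filter_filter, Finset.card_eq_sum_ones]
  rw [Finset.filter_congr (q := fun e => M.edge e = M.edge d), sum_edge_fiber]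
  rintro e -
  exact ⟨fun h => h.2, fun h => ⟨h ▸ hv, h⟩⟩

end Fibers

theorem IsSingleCurve.induction [Finite δ] {M : FourValentMap δ} (hM : M.IsSingleCurve)
    {P : δ → Prop} {b : δ} (hb : P b) (hs : ∀ d, P d → P (M.straight d))
    (ho : ∀ d, P d → P (M.opp d)) (d : δ) : P d := by
  have key : ∀ n : ℕ, P ((M.straight ^ n) b) := by
    intro n
    induction n with
    | zero => simpa using hb
    | succ n ih => rw [pow_succ', Equiv.Perm.mul_apply]; exact hs _ ih
  rcases hM b d with h | h
  · obtain ⟨n, rfl⟩ := h.exists_nat_pow_eq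
    exact key n
  · obtain ⟨n, hn⟩ := h.exists_nat_pow_eq
    rw [← M.opp_opp d, ← hn]
    exact ho _ (key n)

/-- A connected map is exhausted by turning around faces and passing over edges. -/
theorem IsSingleCurve.induction_face [Finite δ] {M : FourValentMap δ} (hM : M.IsSingleCurve)
    {P : δ → Prop} {b : δ} (hb : P b) (hs : ∀ d, P d → P (M.faceNext d))
    (ho : ∀ d, P d → P (M.opp d)) (d : δ) : P d := by
  have hr : ∀ d, P d → P (M.rot (M.rot (M.rot d))) := fun d hd => by
    have := hs _ (ho _ hd)
    rwa [faceNext_apply, M.opp_opp] at this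
  refine hM.induction hb (fun d hd => ?_) ho d
  have := hr _ (hr _ (ho _ hd))
  rwa [M.rot_four] at this

end FourValentMap

/-! ### Vanishing of the first homology of the sphere modulo 2 -/

namespace FourValentMap

section Homology

variable {δ : Type*} [Finite δ] {M : FourValentMap δ}

open scoped Classical in
/-- The linear map from functions on the fibres of `a` to functions on the fibres of `b` which pulls
a function back to darts and then sums it over fibres. -/
noncomputable def incidence {δ X Y : Type*} [Fintype δ] (K : Type*) [Semiring K]
    (a : δ → X) (b : δ → Y) : Matrix Y X K :=
  (Matrix.of fun d y => if b d = y then 1 else 0 : Matrix δ Y K).transpose *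
    (Matrix.of fun (d : δ) x => if a d = x then 1 else 0 : Matrix δ X K)

open scoped Classical in
theorem incidence_mulVec {δ X Y : Type*} [Fintype δ] [Fintype X] {K : Type*} [CommSemiring K]
    (a : δ → X) (b : δ → Y) (z : X → K) (y : Y) :
    (incidence K a b).mulVec z y = ∑ d with b d = y, z (a d) := by
  rw [incidence, ← Matrix.mulVec_mulVec, Finset.sum_filter]
  simp [Matrix.mulVec, dotProduct]

theorem incidence_transpose {δ X Y : Type*} [Fintype δ] {K : Type*} [CommSemiring K]
    (a : δ → X) (b : δ → Y) : (incidence K a b).transpose = incidence K b a := by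
  simp [incidence, Matrix.transpose_mul]

/-- A matrix whose kernel consists of constant functions has corank at most one. -/
theorem card_le_rank_add_one {K X Y : Type*} [Field K] [Fintype X] [Fintype Y] [Nonempty X]
    (N : Matrix Y X K) (h : ∀ z, N.mulVec z = 0 → ∀ x x', z x = z x') :
    Fintype.card X ≤ N.rank + 1 := by
  classical
  have h1 := N.mulVecLin.finrank_range_add_finrank_ker
  rw [Module.finrank_fintype_fun_eq_card] at h1
  have h2 : Module.finrank K (LinearMap.ker N.mulVecLin) ≤ 1 := by
    obtain ⟨x0⟩ := ‹Nonempty X›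
    let φ : LinearMap.ker N.mulVecLin →ₗ[K] K :=
      (LinearMap.proj x0).comp (LinearMap.ker N.mulVecLin).subtype
    have hφ : Function.Injective φ := by
      rw [← LinearMap.ker_eq_bot, LinearMap.ker_eq_bot']
      rintro ⟨z, hz⟩ h0
      ext x
      exact (h z (by simpa using hz) x x0).trans h0
    simpa using LinearMap.finrank_le_finrank_of_injective hφ
  rw [Matrix.rank]
  omega

/-- On a sphere, every cycle modulo two is the boundary of a set of faces. -/
theorem exists_boundary_eq (hM : M.IsSingleCurve) (hP : M.IsPlanar) [Fintype δ] [Nonempty δ]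
    (z : M.Edge → ZMod 2)
    (hz : ∀ d, z (M.edge d) + (z (M.edge (M.rot d)) + (z (M.edge (M.rot (M.rot d))) +
      z (M.edge (M.rot (M.rot (M.rot d)))))) = 0) :
    ∃ h : M.Face → ZMod 2, ∀ d, h (M.face d) + h (M.face (M.opp d)) = z (M.edge d) := by
  classical
  have := Fintype.ofFinite M.Vertex
  have := Fintype.ofFinite M.Edge
  have := Fintype.ofFinite M.Face
  obtain ⟨b⟩ := ‹Nonempty δ›
  have : Nonempty M.Vertex := ⟨M.vertex b⟩
  have : Nonempty M.Face := ⟨M.face b⟩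
  rw [IsPlanar, Nat.card_eq_fintype_card, Nat.card_eq_fintype_card, Nat.card_eq_fintype_card] at hP
  -- `A` and `B` are the boundary maps from edges to vertices and from faces to edges. Connectedness
  -- gives rank `A` ≥ V - 1 (through the transpose) and rank `B` ≥ F - 1.
  set A := incidence (ZMod 2) M.edge M.vertex with hA
  set B := incidence (ZMod 2) M.face M.edge with hB
  have hAz : ∀ y d, A.mulVec y (M.vertex d) = y (M.edge d) + (y (M.edge (M.rot d)) +
      (y (M.edge (M.rot (M.rot d))) + y (M.edge (M.rot (M.rot (M.rot d)))))) := fun y d => by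
    rw [hA, incidence_mulVec, sum_vertex_fiber]
  have hBh : ∀ h d, B.mulVec h (M.edge d) = h (M.face d) + h (M.face (M.opp d)) := fun y d => by
    rw [hB, incidence_mulVec, sum_edge_fiber M (fun d => y (M.face d))]
  have hconst : ∀ {P : δ → ZMod 2}, (∀ d, P d = P (M.faceNext d)) →
      (∀ d, P d + P (M.opp d) = 0) → ∀ d, P d = P b := fun {P} h1 h2 d =>
    hM.induction_face (P := fun d => P d = P b) (b := b) rfl (fun d hd => by rw [← h1, hd])
      (fun d hd => by rw [← hd]; exact (CharTwo.add_eq_zero.1 (h2 d)).symm) d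
  have rankB : Fintype.card M.Face ≤ B.rank + 1 := by
    refine card_le_rank_add_one _ fun h hh => ?_
    have := hconst (P := fun d => h (M.face d)) (fun d => by rw [face_faceNext])
      (fun d => by rw [← hBh, hh]; rfl)
    intro x x'
    obtain ⟨d, rfl⟩ := M.face_surjective x
    obtain ⟨d', rfl⟩ := M.face_surjective x'
    exact (this d).trans (this d').symm
  have rankA : Fintype.card M.Vertex ≤ A.rank + 1 := by
    rw [← Matrix.rank_transpose, hA, incidence_transpose]
    refine card_le_rank_add_one _ fun h hh => ?_
    have h2 : ∀ d, h (M.vertex d) + h (M.vertex (M.opp d)) = 0 := fun d => by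
      rw [← sum_edge_fiber M (fun d => h (M.vertex d)), ← incidence_mulVec, hh]; rfl
    have := hconst (P := fun d => h (M.vertex d)) (fun d => by
      rw [faceNext_apply, vertex_rot, vertex_rot, vertex_rot]
      exact CharTwo.add_eq_zero.1 (h2 d)) h2
    intro x x'
    obtain ⟨d, rfl⟩ := M.vertex_surjective x
    obtain ⟨d', rfl⟩ := M.vertex_surjective x'
    exact (this d).trans (this d').symm
  -- Boundaries are cycles: around a vertex each corner is counted twice, once for each of its two
  -- bounding darts.
  have hle : LinearMap.range B.mulVecLin ≤ LinearMap.ker A.mulVecLin := by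
    rintro _ ⟨h, rfl⟩
    rw [LinearMap.mem_ker]
    ext v
    obtain ⟨d, rfl⟩ := M.vertex_surjective v
    have e1 := M.face_rot (M.rot (M.rot (M.rot d)))
    rw [M.rot_four] at e1
    simp only [Matrix.mulVecLin_apply, hAz, hBh, e1, face_rot, Pi.zero_apply]
    have two : (2 : ZMod 2) = 0 := rfl
    linear_combination (h (M.face d) + h (M.face (M.rot d)) + h (M.face (M.rot (M.rot d))) +
      h (M.face (M.rot (M.rot (M.rot d))))) * two
  have hdim := A.mulVecLin.finrank_range_add_finrank_ker
  rw [Module.finrank_fintype_fun_eq_card] at hdim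
  change A.rank + _ = _ at hdim
  -- By Euler's formula, dim ker `A` ≤ E - (V - 1) = F - 1 ≤ rank `B`.
  have heq := Submodule.eq_of_le_of_finrank_le hle (by change _ ≤ B.rank; omega)
  have hmem : z ∈ LinearMap.ker A.mulVecLin := by
    rw [LinearMap.mem_ker]
    ext v
    obtain ⟨d, rfl⟩ := M.vertex_surjective v
    rw [Matrix.mulVecLin_apply, hAz]; exact hz d
  rw [← heq] at hmem
  obtain ⟨h, hh⟩ := hmem
  exact ⟨h, fun d => by rw [← hBh, ← hh]; rfl⟩

end Homology

end FourValentMap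

/-! ### Simple loops and their two sides -/

namespace FourValentMap

/-- An arc that runs straight on from a vertex and returns to it, without other self-crossings,
from the neighbour counterclockwise of its first dart. -/
structure SimpleLoop {δ : Type*} (M : FourValentMap δ) where
  start : δ
  len : ℕ
  pos : 0 < len
  closes : (M.straight ^ len) start = M.rot.symm start
  simple : ∀ i j : ℕ, i < len → j < len →
    M.vertex ((M.straight ^ i) start) = M.vertex ((M.straight ^ j) start) → i = j

namespace SimpleLoop

variable {δ : Type*} {M : FourValentMap δ} (L : M.SimpleLoop)

/-- The successive darts of the loop. -/
def dart (i : ℕ) : δ := (M.straight ^ i) L.start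

/-- The edge of the dart belongs to the loop. -/
def On (d : δ) : Prop := ∃ i < L.len, M.edge (L.dart i) = M.edge d

/-- The darts whose left faces are reached from the left face of `a` without passing over the
loop. -/
inductive Side (a : δ) : δ → Prop
  | base : Side a a
  | around (d : δ) : Side a d → Side a (M.faceNext d)
  | across (d : δ) : Side a d → ¬ L.On d → Side a (M.opp d)

theorem dart_zero : L.dart 0 = L.start := rfl

theorem dart_succ (i : ℕ) : L.dart (i + 1) = M.straight (L.dart i) := by
  rw [dart, pow_succ', Equiv.Perm.mul_apply, dart]

theorem opp_dart (i : ℕ) : M.opp (L.dart i) = M.rot (M.rot (L.dart (i + 1))) := by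
  rw [dart_succ, opp_eq_rot_rot_straight]

theorem dart_len : L.dart L.len = M.rot (M.rot (M.rot L.start)) := by
  rw [dart, L.closes, rot_symm_apply]

theorem opp_dart_last : M.opp (L.dart (L.len - 1)) = M.rot L.start := by
  rw [opp_dart, Nat.sub_add_cancel L.pos, dart_len, M.rot_four]

theorem dart_injective {i j : ℕ} (hi : i < L.len) (hj : j < L.len) (h : L.dart i = L.dart j) :
    i = j := L.simple i j hi hj (congrArg M.vertex h)

theorem on_opp {d : δ} : L.On (M.opp d) ↔ L.On d := by simp only [On, edge_opp]

theorem on_dart {i : ℕ} (hi : i < L.len) : L.On (L.dart i) := ⟨i, hi, rfl⟩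

theorem on_iff {d : δ} : L.On d ↔ ∃ i < L.len, L.dart i = d ∨ L.dart i = M.opp d := by
  simp only [On, edge_eq_iff]

theorem exists_vertex_of_on {d : δ} (h : L.On d) :
    ∃ i < L.len, M.vertex d = M.vertex (L.dart i) := by
  obtain ⟨i, hi, h | h⟩ := L.on_iff.1 h
  · exact ⟨i, hi, by rw [h]⟩
  · have hd : d = M.opp (L.dart i) := by rw [h, M.opp_opp]
    rcases Nat.lt_or_ge (i + 1) L.len with h1 | h1
    · exact ⟨i + 1, h1, by rw [hd, opp_dart, vertex_rot, vertex_rot]⟩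
    · obtain rfl : i = L.len - 1 := by omega
      exact ⟨0, L.pos, by rw [hd, opp_dart_last, vertex_rot, dart_zero]⟩

/-- By simplicity the loop passes a vertex only once: it goes straight through, except at its base
vertex, where its two ends are neighbours. -/
theorem on_iff_of_vertex_eq {d : δ} {i : ℕ} (hi : i < L.len)
    (hd : M.vertex d = M.vertex (L.dart i)) :
    L.On d ↔ d = L.dart i ∨ (i ≠ 0 ∧ d = M.rot (M.rot (L.dart i))) ∨
      (i = 0 ∧ d = M.rot (L.dart i)) := by
  constructor
  · intro h
    obtain ⟨j, hj, h | h⟩ := L.on_iff.1 h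
    · subst h
      exact .inl (by rw [L.simple j i hj hi hd])
    · obtain rfl : d = M.opp (L.dart j) := by rw [h, M.opp_opp]
      rcases Nat.lt_or_ge (j + 1) L.len with h1 | h1
      · rw [opp_dart, vertex_rot, vertex_rot] at hd
        obtain rfl := L.simple _ _ h1 hi hd
        exact .inr (.inl ⟨by omega, by rw [opp_dart]⟩)
      · obtain rfl : j = L.len - 1 := by omega
        rw [opp_dart_last, vertex_rot] at hd
        obtain rfl := L.simple 0 _ L.pos hi hd
        exact .inr (.inr ⟨rfl, by rw [opp_dart_last, dart_zero]⟩)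
  · rintro (rfl | ⟨h, rfl⟩ | ⟨rfl, rfl⟩)
    · exact L.on_dart hi
    · obtain ⟨k, rfl⟩ := Nat.exists_eq_succ_of_ne_zero h
      rw [Nat.succ_eq_add_one, ← opp_dart, on_opp]
      exact L.on_dart (by omega)
    · rw [dart_zero, ← opp_dart_last, on_opp]
      exact L.on_dart (by have := L.pos; omega)

theorem not_on_rot {i : ℕ} (hi : i < L.len) (h0 : i ≠ 0) : ¬ L.On (M.rot (L.dart i)) := by
  rw [L.on_iff_of_vertex_eq hi (M.vertex_rot _)]
  simp [M.rot_ne, h0, (M.rot_ne _).symm]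

theorem not_on_rot_rot_rot {i : ℕ} (hi : i < L.len) :
    ¬ L.On (M.rot (M.rot (M.rot (L.dart i)))) := by
  rw [L.on_iff_of_vertex_eq hi (by simp only [vertex_rot])]
  simp [M.rot_ne, M.rot_rot_ne, M.rot_rot_rot_ne]

theorem Side.eq_of_invariant {L : M.SimpleLoop} {R : Type*} {a d : δ} (h : L.Side a d)
    (φ : δ → R) (h1 : ∀ d, φ (M.faceNext d) = φ d)
    (h2 : ∀ d, L.Side a d → ¬ L.On d → φ (M.opp d) = φ d) : φ d = φ a := by
  induction h with
  | base => rfl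
  | around d _ ih => rw [h1, ih]
  | across d hd hn ih => rw [h2 d hd hn, ih]

theorem faceNext_dart (i : ℕ) : M.faceNext (L.dart i) = M.rot (L.dart (i + 1)) := by
  rw [faceNext_apply, opp_dart, M.rot_four]

/-- Walk along the left of the loop: at each vertex after the first, exactly one dart leaves to the
left, and it is not on the loop, so it may be crossed. -/
theorem side_start_dart {i : ℕ} (hi : i < L.len) : L.Side L.start (L.dart i) := by
  induction i with
  | zero => exact .base
  | succ i ih =>
    have h1 := Side.around _ (ih (by omega))
    rw [faceNext_dart] at h1
    have h2 := Side.around _ (Side.across _ h1 (L.not_on_rot hi (by omega)))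
    rwa [faceNext_apply, M.opp_opp, M.rot_four] at h2

/-- The same walk along the right, backwards from the last edge. -/
theorem side_opp_dart {i : ℕ} (hi : i < L.len) :
    L.Side (M.opp (L.dart (L.len - 1))) (M.opp (L.dart i)) := by
  obtain ⟨k, hk⟩ : ∃ k, i + k = L.len - 1 := ⟨L.len - 1 - i, by omega⟩
  induction k generalizing i with
  | zero => rw [← hk]; exact .base
  | succ k ih =>
    have h1 := Side.around _ (ih (i := i + 1) (by omega) (by omega))
    rw [faceNext_apply, M.opp_opp] at h1
    have h2 := Side.around _ (Side.across _ h1 (L.not_on_rot_rot_rot (by omega)))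
    rw [faceNext_apply, M.opp_opp, M.rot_four] at h2
    rwa [L.opp_dart i]

variable [Finite δ]

/-- The loop has at most two sides. -/
theorem side_or_side (hM : M.IsSingleCurve) (d : δ) :
    L.Side L.start d ∨ L.Side (M.opp (L.dart (L.len - 1))) d := by
  refine hM.induction_face (b := L.start)
    (P := fun d => L.Side L.start d ∨ L.Side (M.opp (L.dart (L.len - 1))) d) (.inl .base) ?_ ?_ d
  · exact fun d hd => hd.imp (.around d) (.around d)
  · intro d hd
    by_cases hn : L.On d
    · obtain ⟨i, hi, h | h⟩ := L.on_iff.1 hn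
      · exact .inr (h ▸ L.side_opp_dart hi)
      · exact .inl (h ▸ L.side_start_dart hi)
    · exact hd.imp (.across d · hn) (.across d · hn)

/-- A simple loop on a sphere has two sides. -/
theorem exists_two_coloring (hM : M.IsSingleCurve) (hP : M.IsPlanar) :
    ∃ g : M.Face → ZMod 2, g (M.face L.start) = 1 ∧
      (∀ d, L.On d → g (M.face (M.opp d)) = g (M.face d) + 1) ∧
      (∀ d, ¬ L.On d → g (M.face (M.opp d)) = g (M.face d)) := by
  classical
  have := Fintype.ofFinite δ
  have : Nonempty δ := ⟨L.start⟩
  have two : (2 : ZMod 2) = 0 := rfl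
  -- The indicator of the loop is a cycle, as every vertex has zero or two darts on the loop. Its
  -- bounding set of faces is then normalised to contain the left face of `start`.
  let z : M.Edge → ZMod 2 := fun e => if ∃ i < L.len, M.edge (L.dart i) = e then 1 else 0
  have hz : ∀ d, z (M.edge d) = if L.On d then 1 else 0 := fun d =>
    if_congr Iff.rfl rfl rfl
  obtain ⟨h, hh⟩ := exists_boundary_eq hM hP z (by
    intro d
    have base : ∀ i < L.len, z (M.edge (L.dart i)) + (z (M.edge (M.rot (L.dart i))) +
        (z (M.edge (M.rot (M.rot (L.dart i)))) +
        z (M.edge (M.rot (M.rot (M.rot (L.dart i))))))) = 0 := by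
      intro i hi
      simp only [hz, if_neg (L.not_on_rot_rot_rot hi), if_pos (L.on_dart hi)]
      have e1 := L.on_iff_of_vertex_eq hi (M.vertex_rot (L.dart i))
      have e2 := L.on_iff_of_vertex_eq (d := M.rot (M.rot (L.dart i))) hi
        (by simp only [vertex_rot])
      by_cases h0 : i = 0
      · rw [if_pos (e1.2 (.inr (.inr ⟨h0, rfl⟩))), if_neg]
        · rfl
        · rw [e2]
          simp [h0, M.rot_ne, M.rot_rot_ne]
      · rw [if_neg (L.not_on_rot hi h0), if_pos (e2.2 (.inr (.inl ⟨h0, rfl⟩)))]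
        rfl
    by_cases hv : ∃ i < L.len, M.vertex d = M.vertex (L.dart i)
    · obtain ⟨i, hi, hv⟩ := hv
      have := base i hi
      rcases M.vertex_eq_iff.1 hv with h | h | h | h <;> rw [h] <;> (try simp only [M.rot_four]) <;>
        linear_combination this
    · have hn : ∀ e, M.vertex e = M.vertex d → z (M.edge e) = 0 := fun e he => by
        rw [hz, if_neg]
        exact fun hon => hv (he ▸ L.exists_vertex_of_on hon)
      rw [hn d rfl, hn (M.rot d) (M.vertex_rot d), hn (M.rot (M.rot d)) (by simp only [vertex_rot]),
        hn (M.rot (M.rot (M.rot d))) (by simp only [vertex_rot])]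
      simp)
  refine ⟨fun f => h f + h (M.face L.start) + 1, ?_, fun d hd => ?_, fun d hd => ?_⟩
  · linear_combination h (M.face L.start) * two
  · have := hh d
    rw [hz, if_pos hd] at this
    linear_combination this - h (M.face d) * two
  · have := hh d
    rw [hz, if_neg hd] at this
    linear_combination this - h (M.face d) * two

end SimpleLoop

end FourValentMap

/-! ### Euler characteristic and Gauss–Bonnet for the disc -/

section Restriction

variable {K X Y : Type*} [CommSemiring K] [Fintype X]

open scoped Classical in
theorem Matrix.submatrix_mulVec_eq_extend (N : Matrix Y X K) (A : Finset X) (B : Finset Y)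
    (z : A → K) (y : B) :
    (N.submatrix (fun b : B => b.1) (fun a : A => a.1)).mulVec z y =
      N.mulVec (fun x => if h : x ∈ A then z ⟨x, h⟩ else 0) y := by
  simp only [Matrix.mulVec, dotProduct, Matrix.submatrix_apply]
  rw [← Finset.sum_subset (Finset.subset_univ A), ← Finset.sum_coe_sort A]
  · exact Finset.sum_congr rfl fun x _ => by simp
  · intro x _ hx
    simp [hx]

end Restriction

theorem Matrix.rank_lt_of_mulVec_eq_zero {K X Y : Type*} [Field K] [Fintype X] [Fintype Y]
    (N : Matrix Y X K) {z : X → K} (hz : z ≠ 0) (h : N.mulVec z = 0) :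
    N.rank < Fintype.card X := by
  classical
  have h1 := N.mulVecLin.finrank_range_add_finrank_ker
  rw [Module.finrank_fintype_fun_eq_card] at h1
  have : 0 < Module.finrank K (LinearMap.ker N.mulVecLin) := by
    refine Module.finrank_pos_iff_exists_ne_zero.2 ⟨⟨z, by simpa using h⟩, ?_⟩
    simpa using hz
  rw [Matrix.rank]
  omega

namespace FourValentMap.SimpleLoop

variable {δ : Type*} {M : FourValentMap δ} (L : M.SimpleLoop) [Fintype δ]

open scoped Classical in
/-- The Gauss–Bonnet inequality for the disc on the left of a simple loop. -/
theorem exists_disc (hM : M.IsSingleCurve) (hP : M.IsPlanar) :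
    ∃ S : Finset M.Face, (∀ d, M.face d ∈ S ↔ L.Side L.start d) ∧
      (Finset.univ.filter fun d => M.face d ∈ S).card + 3 ≤ 4 * S.card := by
  have := Fintype.ofFinite M.Vertex
  have := Fintype.ofFinite M.Edge
  have := Fintype.ofFinite M.Face
  have : Nonempty δ := ⟨L.start⟩
  have two : (2 : ZMod 2) = 0 := rfl
  obtain ⟨g, g1, gon, goff⟩ := L.exists_two_coloring hM hP
  have gcases : ∀ x : ZMod 2, x ≠ 1 → x = 0 := by decide
  have gside : ∀ {a d}, L.Side a d → g (M.face d) = g (M.face a) := fun h =>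
    h.eq_of_invariant (fun d => g (M.face d)) (fun d => by rw [face_faceNext])
      (fun d _ hn => goff d hn)
  have gdart : ∀ i < L.len, g (M.face (L.dart i)) = 1 := fun i hi => by
    rw [gside (L.side_start_dart hi), g1]
  have gopp : ∀ i < L.len, g (M.face (M.opp (L.dart i))) = 0 := fun i hi => by
    rw [gon _ (L.on_dart hi), gdart i hi]; rfl
  have hlast : L.len - 1 < L.len := by have := L.pos; omega
  set r := M.opp (L.dart (L.len - 1)) with hr
  have gr : g (M.face r) = 0 := gopp _ hlast
  have hleft : ∀ d, g (M.face d) = 1 ↔ L.Side L.start d := fun d => by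
    refine ⟨fun h => (L.side_or_side hM d).resolve_right fun h' => ?_, fun h => by rw [gside h, g1]⟩
    rw [gside h', gr] at h
    exact zero_ne_one h
  have hright : ∀ d, g (M.face d) = 0 → L.Side r d := fun d h =>
    (L.side_or_side hM d).resolve_left fun h' => by
      rw [(hleft d).2 h'] at h
      exact one_ne_zero h
  -- `S`, `A` and `W` are the faces, edges and vertices of the closed disc.
  let S : Finset M.Face := Finset.univ.filter fun f => g f = 1
  have hS : ∀ d, M.face d ∈ S ↔ g (M.face d) = 1 := fun d => by simp [S]
  let A : Finset M.Edge := (Finset.univ.filter fun d => M.face d ∈ S).image M.edge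
  have hA : ∀ d, M.edge d ∈ A ↔ g (M.face d) = 1 ∨ g (M.face (M.opp d)) = 1 := fun d => by
    simp only [A, Finset.mem_image, Finset.mem_filter, Finset.mem_univ, true_and, hS]
    constructor
    · rintro ⟨e, he, h⟩
      rcases M.edge_eq_iff.1 h with rfl | rfl
      exacts [.inl he, .inr he]
    · rintro (h | h)
      exacts [⟨d, h, rfl⟩, ⟨_, h, M.edge_opp d⟩]
  let W : Finset M.Vertex := (Finset.univ.filter fun d => M.face d ∈ S).image M.vertex
  have hW : ∀ d, M.vertex d ∈ W ↔ ∃ e, M.vertex e = M.vertex d ∧ g (M.face e) = 1 := fun d => by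
    simp only [W, Finset.mem_image, Finset.mem_filter, Finset.mem_univ, true_and, hS]
    exact exists_congr fun _ => and_comm
  have hAW : ∀ d, M.edge d ∈ A → M.vertex d ∈ W := fun d hd => by
    rw [hW]
    rcases (hA d).1 hd with h | h
    · exact ⟨d, rfl, h⟩
    · refine ⟨M.faceNext (M.opp d), ?_, by rwa [face_faceNext]⟩
      simp only [faceNext_apply, M.opp_opp, vertex_rot]
  -- rank count
  have hrank : A.card + 1 ≤ W.card + S.card := by
    set N := (incidence (ZMod 2) M.edge M.vertex).submatrix
      (fun v : W => v.1) (fun e : A => e.1) with hN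
    set B := (incidence (ZMod 2) M.face M.edge).submatrix
      (fun e : A => e.1) (fun f : S => f.1) with hB
    -- The all-ones covector kills the boundary map, since each edge has two ends.
    have h1 : N.rank < W.card := by
      rw [← Matrix.rank_transpose, ← Fintype.card_coe W]
      refine Matrix.rank_lt_of_mulVec_eq_zero _ (z := fun _ => 1) (fun h => ?_) ?_
      · exact one_ne_zero (congrFun h ⟨M.vertex L.start, (hW _).2 ⟨_, rfl, g1⟩⟩)
      · rw [hN, Matrix.transpose_submatrix, incidence_transpose]
        ext ⟨e, he⟩
        obtain ⟨d, rfl⟩ := M.edge_surjective e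
        rw [Matrix.submatrix_mulVec_eq_extend, incidence_mulVec,
          sum_edge_fiber M (fun d => if h : M.vertex d ∈ W then (1 : ZMod 2) else 0),
          dif_pos (hAW _ he), dif_pos (hAW _ (by rwa [edge_opp]))]
        rfl
    -- A cycle in the disc, extended by zero, bounds some `h` on the sphere. Outside the disc `h` is
    -- constant, because that side is connected and the cycle vanishes there; adding this constant
    -- makes `h` supported on `S`.
    have h2 : LinearMap.ker N.mulVecLin ≤ LinearMap.range B.mulVecLin := by
      intro z hz
      have hz : N.mulVec z = 0 := by simpa using hz
      obtain ⟨h, hh⟩ := exists_boundary_eq hM hP (fun e => if he : e ∈ A then z ⟨e, he⟩ else 0) (by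
        intro d
        rw [← sum_vertex_fiber M (fun d => if he : M.edge d ∈ A then z ⟨M.edge d, he⟩ else 0)]
        by_cases hd : M.vertex d ∈ W
        · have := congrFun hz ⟨M.vertex d, hd⟩
          rwa [hN, Matrix.submatrix_mulVec_eq_extend, incidence_mulVec] at this
        · refine Finset.sum_eq_zero fun e he => dif_neg fun he' => hd ?_
          rw [← (Finset.mem_filter.1 he).2]
          exact hAW e he')
      have hout : ∀ d, g (M.face d) = 0 → h (M.face d) = h (M.face r) := fun d hd =>
        (hright d hd).eq_of_invariant (fun d => h (M.face d)) (fun d => by rw [face_faceNext])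
          (fun d hd hn => by
            have e0 : g (M.face d) = 0 := by rw [gside hd, gr]
            have := hh d
            rw [dif_neg] at this
            · exact (CharTwo.add_eq_zero.1 this).symm
            · rw [hA, goff d hn, e0]; decide)
      refine ⟨fun f => h f.1 + h (M.face r), ?_⟩
      ext ⟨e, he⟩
      obtain ⟨d, rfl⟩ := M.edge_surjective e
      have hext : ∀ d, (if hf : M.face d ∈ S then h (M.face d) + h (M.face r) else 0) =
          h (M.face d) + h (M.face r) := fun d => by
        split_ifs with hf
        · rfl
        · rw [hout d (gcases _ fun h => hf ((hS d).2 h))]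
          linear_combination - h (M.face r) * two
      have := hh d
      rw [dif_pos he] at this
      rw [Matrix.mulVecLin_apply, hB, Matrix.submatrix_mulVec_eq_extend, incidence_mulVec,
        sum_edge_fiber M
          (fun d => if hf : M.face d ∈ S then h (M.face d) + h (M.face r) else 0), hext, hext]
      linear_combination this + h (M.face r) * two
    have h3 := N.mulVecLin.finrank_range_add_finrank_ker
    rw [Module.finrank_fintype_fun_eq_card, Fintype.card_coe] at h3
    change N.rank + _ = _ at h3
    have h4 := Submodule.finrank_mono h2
    have h5 := LinearMap.finrank_range_le B.mulVecLin
    rw [Module.finrank_fintype_fun_eq_card, Fintype.card_coe] at h5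
    omega
  -- counting darts
  have hfour := M.four_mul_card W
  have htwo := M.two_mul_card A
  have hinj : Set.InjOn (fun i => M.opp (L.dart i)) (Finset.range L.len) := fun i hi j hj h =>
    L.dart_injective (by simpa using hi) (by simpa using hj) (M.opp.injective h)
  -- Besides the darts with a face of `S` on their left, the edges of `A` contain the reversed darts
  -- of the loop.
  have hedges : (Finset.univ.filter fun d => M.face d ∈ S).card + L.len ≤
      (Finset.univ.filter fun d => M.edge d ∈ A).card := by
    have hc := Finset.card_image_of_injOn hinj
    rw [Finset.card_range] at hc
    rw [← hc, ← Finset.card_union_of_disjoint]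
    · refine Finset.card_le_card fun d hd => ?_
      simp only [Finset.mem_union, Finset.mem_filter, Finset.mem_univ, true_and, Finset.mem_image,
        Finset.mem_range, hS] at hd
      rw [Finset.mem_filter, hA]
      refine ⟨Finset.mem_univ _, ?_⟩
      rcases hd with h | ⟨i, hi, rfl⟩
      · exact .inl h
      · exact .inr (by rw [M.opp_opp]; exact gdart i hi)
    · rw [Finset.disjoint_left]
      intro d hd hd'
      obtain ⟨i, hi, rfl⟩ := Finset.mem_image.1 hd'
      rw [Finset.mem_filter, hS, gopp i (Finset.mem_range.1 hi)] at hd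
      exact zero_ne_one hd.2
  -- Corners outside the disc: two at each loop vertex, and a third one, `rot start`, at the base
  -- vertex.
  have hvertices : (Finset.univ.filter fun d => M.vertex d ∈ W).card ≤
      (Finset.univ.filter fun d => M.face d ∈ S).card + (2 * L.len + 1) := by
    set T1 := (Finset.range L.len).image fun i => M.rot (M.rot (L.dart i)) with hT1
    set T2 := (Finset.range L.len).image fun i => M.rot (M.rot (M.rot (L.dart i))) with hT2
    have c1 : T1.card ≤ L.len := Finset.card_image_le.trans (Finset.card_range _).le
    have c2 : T2.card ≤ L.len := Finset.card_image_le.trans (Finset.card_range _).le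
    have hsub : (Finset.univ.filter fun d => M.vertex d ∈ W) ⊆
        (Finset.univ.filter fun d => M.face d ∈ S) ∪ (T1 ∪ T2 ∪ {M.rot L.start}) := by
      intro d hd
      rw [Finset.mem_filter, hW] at hd
      obtain ⟨-, e, he, ge⟩ := hd
      by_contra hcon
      simp only [Finset.mem_union, Finset.mem_filter, Finset.mem_univ, true_and, not_or, hS, hT1,
        hT2, Finset.mem_image, Finset.mem_range, Finset.mem_singleton, not_exists, not_and] at hcon
      obtain ⟨k0, ⟨k1, k2⟩, k3⟩ := hcon
      have hv : ∃ i < L.len, M.vertex d = M.vertex (L.dart i) := by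
        by_contra hv
        have hn : ∀ x, M.vertex x = M.vertex d → g (M.face (M.rot x)) = g (M.face x) := by
          intro x hx
          rw [← M.face_rot x, goff]
          intro hon
          obtain ⟨i, hi, h⟩ := L.exists_vertex_of_on hon
          exact hv ⟨i, hi, by rw [← hx, ← h, vertex_rot]⟩
        have n1 := hn d rfl
        have n2 := hn (M.rot d) (M.vertex_rot _)
        have n3 := hn (M.rot (M.rot d)) (by simp only [vertex_rot])
        rcases M.vertex_eq_iff.1 he with h | h | h | h <;> rw [h] at ge
        · exact k0 ge
        · exact k0 (n1 ▸ ge)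
        · exact k0 (n1 ▸ n2 ▸ ge)
        · exact k0 (n1 ▸ n2 ▸ n3 ▸ ge)
      obtain ⟨i, hi, hv⟩ := hv
      rcases M.vertex_eq_iff.1 hv with rfl | rfl | rfl | rfl
      · exact k0 (gdart i hi)
      · cases i with
        | zero => exact k3 (by rw [dart_zero])
        | succ i => exact k0 (by rw [← faceNext_dart, face_faceNext]; exact gdart i (by omega))
      · exact k1 i hi rfl
      · exact k2 i hi rfl
    have u1 := Finset.card_le_card hsub
    have u2 := Finset.card_union_le (Finset.univ.filter fun d => M.face d ∈ S)
      (T1 ∪ T2 ∪ {M.rot L.start})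
    have u3 := Finset.card_union_le (T1 ∪ T2) {M.rot L.start}
    have u4 := Finset.card_union_le T1 T2
    rw [Finset.card_singleton] at u3
    omega
  -- With I darts facing `S` and ℓ = `len`: 2I + 2ℓ + 4 ≤ 4|A| + 4 ≤ 4|W| + 4|S| ≤ I + 2ℓ + 1 +
  -- 4|S|.
  exact ⟨S, fun d => (hS d).trans (hleft d), by omega⟩

end FourValentMap.SimpleLoop

/-! ### Traversing the curve; faces with few sides -/

namespace FourValentMap

variable {δ : Type*} {M : FourValentMap δ}

theorem straight_opp_straight (d : δ) : M.straight (M.opp (M.straight d)) = M.opp d := by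
  rw [straight_apply, M.opp_opp, ← opp_eq_rot_rot_straight]

theorem straight_pow_opp (n : ℕ) (d : δ) :
    (M.straight ^ n) (M.opp ((M.straight ^ n) d)) = M.opp d := by
  induction n with
  | zero => rfl
  | succ n ih =>
    rw [show M.straight ^ (n + 1) = M.straight * M.straight ^ n from pow_succ' _ _,
      Equiv.Perm.mul_apply _ _ d, ← pow_succ', pow_succ, Equiv.Perm.mul_apply,
      straight_opp_straight, ih]

/-- Running straight on, one never meets the same edge in the opposite direction. -/
theorem straight_pow_ne_opp (n : ℕ) (d : δ) : (M.straight ^ n) d ≠ M.opp d := by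
  intro h
  -- Such a walk would be its own reverse. Its midpoint would be an edge equal to its own reverse
  -- (`n` even) or a crossing where the curve turns back (`n` odd).
  have hk : ∀ k, k ≤ n → (M.straight ^ (n - k)) d = M.opp ((M.straight ^ k) d) := by
    intro k hk
    apply (M.straight ^ k).injective
    rw [straight_pow_opp, ← Equiv.Perm.mul_apply, ← pow_add, Nat.add_sub_cancel' hk, h]
  rcases Nat.even_or_odd' n with ⟨k, rfl | rfl⟩
  · have := hk k (by omega)
    rw [show 2 * k - k = k by omega] at this
    exact M.opp_ne _ this.symm
  · have := hk k (by omega)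
    rw [show 2 * k + 1 - k = k + 1 by omega, pow_succ', Equiv.Perm.mul_apply, straight_apply] at this
    exact M.rot_rot_ne _ this

/-- Running straight on from the edge of `b`, every other edge is met within one turn. -/
theorem IsSingleCurve.exists_straight_pow_eq [Finite δ] (hM : M.IsSingleCurve) (b d : δ) :
    ∃ i < Nat.card M.Edge, (M.straight ^ i) b = d ∨ (M.straight ^ i) b = M.opp d := by
  set p := Function.minimalPeriod M.straight b with hp
  have hper : 0 < p := Function.minimalPeriod_pos_of_mem_periodicPts
    (Function.mem_periodicPts.2 ⟨orderOf M.straight, orderOf_pos _, by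
      rw [Function.IsPeriodicPt, Function.IsFixedPt, Equiv.Perm.iterate_eq_pow, pow_orderOf_eq_one]
      rfl⟩)
  -- Within one period no edge repeats, in either direction, so the period is at most the number of
  -- edges.
  have hinj : Function.Injective fun i : Fin p => M.edge ((M.straight ^ (i : ℕ)) b) := by
    intro i j h
    rcases M.edge_eq_iff.1 h with h | h
    · rw [← Equiv.Perm.iterate_eq_pow, ← Equiv.Perm.iterate_eq_pow,
        Function.iterate_eq_iterate_iff_of_lt_minimalPeriod i.2 j.2] at h
      exact Fin.ext h
    · exfalso
      rcases le_total (i : ℕ) j with hij | hij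
      · refine M.straight_pow_ne_opp (j - i) ((M.straight ^ (i : ℕ)) b) ?_
        rw [← Equiv.Perm.mul_apply, ← pow_add, Nat.sub_add_cancel hij, h, M.opp_opp]
      · refine M.straight_pow_ne_opp (i - j) ((M.straight ^ (j : ℕ)) b) ?_
        rw [← Equiv.Perm.mul_apply, ← pow_add, Nat.sub_add_cancel hij, h]
  have hle : p ≤ Nat.card M.Edge := by
    simpa using Nat.card_le_card_of_injective _ hinj
  have key : ∀ e, M.straight.SameCycle b e → ∃ i < Nat.card M.Edge, (M.straight ^ i) b = e := by
    intro e h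
    obtain ⟨n, rfl⟩ := h.exists_nat_pow_eq
    refine ⟨n % p, (Nat.mod_lt _ hper).trans_le hle, ?_⟩
    rw [← Equiv.Perm.iterate_eq_pow, ← Equiv.Perm.iterate_eq_pow, Function.iterate_mod_minimalPeriod_eq]
  rcases hM b d with h | h
  · obtain ⟨i, hi, h⟩ := key _ h
    exact ⟨i, hi, .inl h⟩
  · obtain ⟨i, hi, h⟩ := key _ h
    exact ⟨i, hi, .inr h⟩

theorem faceNext_ne [Finite δ] {d : δ} (h : 1 < M.sides (M.face d)) : M.faceNext d ≠ d := by
  intro hd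
  have key : ∀ e, M.face e = M.face d → e = d := by
    intro e he
    obtain ⟨n, rfl⟩ := (M.face_eq_iff.1 he.symm).exists_nat_pow_eq
    rw [← Equiv.Perm.iterate_eq_pow]
    exact Function.iterate_fixed hd n
  have : Subsingleton {e // M.face e = M.face d} :=
    ⟨fun x y => Subtype.ext ((key _ x.2).trans (key _ y.2).symm)⟩
  have := Finite.card_le_one_iff_subsingleton.2 this
  rw [sides] at h
  omega

theorem faceNext_of_sides_eq_two [Finite δ] {d : δ} (h : M.sides (M.face d) = 2) :
    M.faceNext d ≠ d ∧ M.faceNext (M.faceNext d) = d := by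
  have hne : M.faceNext d ≠ d := faceNext_ne (by omega)
  refine ⟨hne, ?_⟩
  obtain ⟨x, y, -, hxy⟩ := Nat.card_eq_two_iff.1 h
  have hall : ∀ e (he : M.face e = M.face d), e = x.1 ∨ e = y.1 := fun e he => by
    have : (⟨e, he⟩ : {e // M.face e = M.face d}) ∈ ({x, y} : Set _) := hxy ▸ Set.mem_univ _
    rcases this with h | h
    exacts [.inl (congrArg Subtype.val h), .inr (congrArg Subtype.val h)]
  have hne' : M.faceNext (M.faceNext d) ≠ M.faceNext d := fun h => hne (M.faceNext.injective h)
  have a1 := hall d rfl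
  have a2 := hall (M.faceNext d) (M.face_faceNext d)
  have a3 := hall (M.faceNext (M.faceNext d)) (by simp only [face_faceNext])
  grind

/-- If both `d` and `opp d` bounded the triangle, its third dart would be `faceNext d`, leaving no
possible value for `faceNext (opp d)`. This excludes a triangle glued to itself, which is not a pair
of distinct triangles. -/
theorem face_opp_ne_of_sides_eq_three [Finite δ] {d : δ} (h : M.sides (M.face d) = 3) :
    M.face (M.opp d) ≠ M.face d := by
  classical
  intro he
  have := Fintype.ofFinite δ
  have hn : ∀ x, M.faceNext x ≠ M.opp x := fun x hx => by
    rw [faceNext_apply] at hx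
    exact M.rot_rot_rot_ne _ hx
  have hdn : M.faceNext d ≠ d := faceNext_ne (by omega)
  have hn1 := hn d
  have hn2 := hn (M.opp d)
  rw [M.opp_opp] at hn2
  set S := Finset.univ.filter fun e => M.face e = M.face d with hS
  have hcard : S.card = 3 := by
    rw [← h, sides, Nat.card_eq_fintype_card, Fintype.card_subtype]
  have hinv : ∀ x, x ∈ S → M.faceNext x ∈ S := fun x hx => by
    simpa [hS, face_faceNext] using hx
  have hd : d ∈ S := by simp [hS]
  have ho : M.opp d ∈ S := by simpa [hS] using he
  have hsub : ({d, M.opp d, M.faceNext d} : Finset δ) = S := by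
    refine Finset.eq_of_subset_of_card_le (fun x => ?_) ?_
    · simp only [Finset.mem_insert, Finset.mem_singleton]
      rintro (rfl | rfl | rfl)
      exacts [hd, ho, hinv _ hd]
    · rw [hcard, Finset.card_insert_of_notMem, Finset.card_pair hn1.symm]
      simp [(M.opp_ne d).symm, hdn.symm]
  have hmem := hinv _ ho
  simp only [← hsub, Finset.mem_insert, Finset.mem_singleton] at hmem
  rcases hmem with h' | h' | h'
  · exact hn2 h'
  · exact faceNext_ne (d := M.opp d) (by rw [he]; omega) h'
  · exact M.opp_ne d (M.faceNext.injective h')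

end FourValentMap

/-! ### Bigons in ascending diagrams -/

namespace KnotDiagram

open FourValentMap

variable {δ : Type*} {D : KnotDiagram δ}

theorem isOver_opp_iff (d : δ) : D.isOver (D.opp d) ↔ D.isOver (D.straight d) := by
  rw [straight_apply, D.isOver_rot, D.isOver_rot, not_not]

/-- In an ascending diagram, the side of a bigon that is met first passes under at both ends. -/
theorem AscendingFrom.not_isOver_of_bigon {b e : δ} (hb : D.AscendingFrom b) {i j : ℕ}
    (hi : 0 < i) (hij : i < j) (hj : j < Nat.card D.Edge)
    (h : (D.straight ^ j) b = e ∨ (D.straight ^ j) b = D.opp e)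
    (htail : D.vertex ((D.straight ^ i) b) = D.vertex e)
    (hhead : D.vertex (D.opp ((D.straight ^ i) b)) = D.vertex (D.opp e))
    (hne : D.straight ((D.straight ^ i) b) ≠ D.opp e) :
    ¬ D.isOver ((D.straight ^ i) b) ∧ ¬ D.isOver (D.opp ((D.straight ^ i) b)) := by
  have succ : ∀ k, D.straight ((D.straight ^ k) b) = (D.straight ^ (k + 1)) b := fun k => by
    rw [pow_succ', Equiv.Perm.mul_apply]
  rw [D.isOver_opp_iff, succ]
  rw [vertex_opp, succ] at hhead
  rw [succ] at hne
  -- The second side is traversed parallel to the first, with ends met at `j` and `j + 1`, or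
  -- antiparallel, with the ends in the opposite order. In the latter case `hne` keeps the sides
  -- from being consecutive, so that `i + 1 < j`.
  rcases h with rfl | rfl'
  · rw [vertex_opp, succ] at hhead
    exact ⟨(hb i j hi hij hj.le htail).1, (hb (i + 1) (j + 1) (by omega) (by omega) hj hhead).1⟩
  · have h' : e = D.opp ((D.straight ^ j) b) := by rw [rfl', D.opp_opp]
    rw [← rfl'] at hhead hne
    rw [h', vertex_opp, succ] at htail
    have hij' : i + 1 ≠ j := fun h => hne (by rw [h])
    exact ⟨(hb i (j + 1) hi (by omega) hj htail).1,
      (hb (i + 1) j (by omega) (by omega) hj.le hhead).1⟩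

theorem AscendingFrom.not_isOver_of_sides {b d d' : δ} (hb : D.AscendingFrom b)
    (h1 : D.opp d' = D.rot d) (h2 : D.opp d = D.rot d') {i j : ℕ}
    (hi : 0 < i) (hij : i < j) (hj : j < Nat.card D.Edge)
    (hid : (D.straight ^ i) b = d ∨ (D.straight ^ i) b = D.opp d)
    (hjd : (D.straight ^ j) b = d' ∨ (D.straight ^ j) b = D.opp d') :
    ¬ D.isOver d ∧ ¬ D.isOver (D.opp d) := by
  rcases hid with h | h
  · rw [← h]
    refine hb.not_isOver_of_bigon (e := D.opp d') hi hij hj ?_ ?_ ?_ ?_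
    · rw [D.opp_opp]; exact hjd.symm
    · rw [h, h1, vertex_rot]
    · rw [h, D.opp_opp, h2, vertex_rot]
    · rw [h, D.opp_opp, straight_apply, h2]
      exact D.rot_rot_rot_ne d'
  · have := hb.not_isOver_of_bigon (e := d') hi hij hj hjd (by rw [h, h2, vertex_rot])
      (by rw [h, D.opp_opp, h1, vertex_rot]) (by
        rw [h, h1, straight_apply, D.opp_opp]
        exact D.rot_ne _)
    rw [h, D.opp_opp] at this
    exact this.symm

/-! ### Orienting the loop and excluding bigons -/

namespace LoopTangle

variable (L : D.LoopTangle)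

theorem onLoop_iff {d : δ} :
    L.OnLoop d ↔ ∃ i < L.len, D.edge ((D.straight ^ i) L.start) = D.edge d := by
  refine exists_congr fun i => and_congr_right fun _ => ?_
  rw [edge_eq_iff, eq_comm (a := d), eq_comm (a := D.opp d)]

/-- The loop of a loop-tangle, oriented so that the disc is on its left. -/
theorem exists_simpleLoop : ∃ P : D.SimpleLoop, (∀ d, P.On d ↔ L.OnLoop d) ∧
    ∀ d, P.Side P.start d ↔ L.LeftInDisc d := by
  have hlen := L.len_pos
  obtain ⟨P, hon, hend⟩ : ∃ P : D.SimpleLoop, (∀ d, P.On d ↔ L.OnLoop d) ∧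
      ∀ d, L.IsEnd d ↔ d = P.start ∨ d = D.rot P.start := by
    have hsucc : ∀ i, D.opp ((D.straight ^ i) L.start) =
        D.rot (D.rot ((D.straight ^ (i + 1)) L.start)) := fun i => by
      rw [opp_eq_rot_rot_straight, pow_succ', Equiv.Perm.mul_apply]
    have hlast := hsucc (L.len - 1)
    rw [Nat.sub_add_cancel hlen] at hlast
    have hopp : ∀ d e, D.opp d = e ↔ d = D.opp e := fun d e =>
      ⟨fun h => by rw [← h, D.opp_opp], fun h => by rw [h, D.opp_opp]⟩
    -- In the first case the disc lies to the right, so the loop is reversed: it then starts with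
    -- the reverse of its last edge, which is `rot.symm start`.
    rcases L.crosses_itself with h | h
    · rw [h] at hlast
      have hpow : ∀ i < L.len, (D.straight ^ i) (D.rot.symm L.start) =
          D.opp ((D.straight ^ (L.len - 1 - i)) L.start) := by
        intro i hi
        induction i with
        | zero => rw [Nat.sub_zero, hlast, rot_symm_apply]; rfl
        | succ i ih =>
          rw [pow_succ', Equiv.Perm.mul_apply, ih (by omega),
            show L.len - 1 - i = L.len - 1 - (i + 1) + 1 by omega, pow_succ' D.straight,
            Equiv.Perm.mul_apply, straight_opp_straight]
      have hvert : ∀ i < L.len, D.vertex ((D.straight ^ i) (D.rot.symm L.start)) =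
          D.vertex ((D.straight ^ (if i = 0 then 0 else L.len - i)) L.start) := by
        intro i hi
        split_ifs with h0
        · subst h0
          rw [rot_symm_apply]
          simp [vertex_rot]
        · rw [hpow i hi, hsucc, vertex_rot, vertex_rot,
            show L.len - 1 - i + 1 = L.len - i by omega]
      refine ⟨⟨D.rot.symm L.start, L.len, hlen, ?_, ?_⟩, fun d => ?_, fun d => ?_⟩
      · obtain ⟨n, hn⟩ := Nat.exists_eq_succ_of_ne_zero hlen.ne'
        rw [hn, Nat.succ_eq_add_one, pow_succ', Equiv.Perm.mul_apply, hpow n (by omega),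
          show L.len - 1 - n = 0 by omega, straight_apply, D.opp_opp, rot_symm_apply,
          rot_symm_apply, D.rot_four]
        rfl
      · intro i j hi hj hv
        rw [hvert i hi, hvert j hj] at hv
        have := L.simple _ _ (by split_ifs <;> omega) (by split_ifs <;> omega) hv
        split_ifs at this <;> omega
      · rw [onLoop_iff]
        constructor
        · rintro ⟨i, hi, he⟩
          have hi : i < L.len := hi
          refine ⟨L.len - 1 - i, by omega, ?_⟩
          rw [← he, SimpleLoop.dart, hpow i hi, edge_opp]
        · rintro ⟨i, hi, he⟩
          refine ⟨L.len - 1 - i, by change _ < L.len; omega, ?_⟩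
          rw [← he, SimpleLoop.dart, hpow _ (by omega), edge_opp,
            show L.len - 1 - (L.len - 1 - i) = i by omega]
      · change _ ↔ d = D.rot.symm L.start ∨ d = D.rot (D.rot.symm L.start)
        rw [IsEnd, hopp, hlast, ← rot_symm_apply, Equiv.apply_symm_apply, or_comm]
    · rw [h, rot_symm_apply, D.rot_four] at hlast
      exact ⟨⟨L.start, L.len, hlen, h, L.simple⟩, fun d => L.onLoop_iff.symm,
        fun d => by rw [IsEnd, hopp, hlast]⟩
  refine ⟨P, hon, fun d => ⟨fun h => ?_, fun h => ?_⟩⟩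
  · induction h with
    | base => exact .corner _ ((hend _).2 (.inl rfl)) ((hend _).2 (.inr rfl))
    | around d _ ih => exact .around d ih
    | across d _ hn ih => exact .across d ih (mt (hon d).2 hn)
  · induction h with
    | corner d h1 h2 =>
      rw [hend] at h1 h2
      rcases h1 with rfl | rfl
      · exact .base
      · rcases h2 with h2 | h2
        · exact absurd h2 (D.rot_rot_ne _)
        · exact absurd h2 (D.rot_ne _)
    | around d _ ih => exact .around d ih
    | across d _ hn ih => exact .across d ih (mt (hon d).1 hn)

variable {L} [Finite δ]

theorem face_mem_disc_iff {d : δ} : D.face d ∈ L.disc ↔ L.LeftInDisc d := by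
  refine ⟨?_, fun h => ⟨d, h, rfl⟩⟩
  rintro ⟨e, he, h⟩
  obtain ⟨n, rfl⟩ := (D.face_eq_iff.1 h).exists_nat_pow_eq
  clear h
  induction n with
  | zero => exact he
  | succ n ih => rw [pow_succ', Equiv.Perm.mul_apply]; exact .around _ ih

/-- If an ascending diagram has its base point outside the disc, then every bigon in the disc is
removable. -/
theorem MinimalAscending.minimalGraph (h : L.MinimalAscending) : L.MinimalGraph := by
  obtain ⟨⟨b, hb, hb1, hb2⟩, hmin⟩ := h
  intro f hf
  refine ⟨(hmin f hf).1, fun h2 => (hmin f hf).2 ⟨h2, ?_⟩⟩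
  obtain ⟨d, rfl⟩ := D.face_surjective f
  obtain ⟨hd, hd'⟩ := D.faceNext_of_sides_eq_two h2
  set d' := D.faceNext d with hdef
  have hface : D.face d' = D.face d := D.face_faceNext d
  have e1 : D.opp d = D.rot d' := by rw [hdef, faceNext_apply, D.rot_four]
  have e2 : D.opp d' = D.rot d := by rw [← D.rot_four (D.opp d'), ← faceNext_apply, hd']
  -- The base edge is not a side of the bigon, so both sides are met at positive times, as
  -- `AscendingFrom` requires.
  have hb0 : ∀ e, D.face e = D.face d → b ≠ e ∧ b ≠ D.opp e := fun e he =>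
    ⟨fun h => hb1 (by rwa [h, he]), fun h => hb2 (by rwa [h, D.opp_opp, he])⟩
  obtain ⟨i, hi, hid⟩ := D.isSingleCurve.exists_straight_pow_eq b d
  obtain ⟨j, hj, hjd⟩ := D.isSingleCurve.exists_straight_pow_eq b d'
  have hi0 : 0 < i := Nat.pos_of_ne_zero fun h => by
    subst h
    exact hid.elim (hb0 d rfl).1 (hb0 d rfl).2
  have hj0 : 0 < j := Nat.pos_of_ne_zero fun h => by
    subst h
    exact hjd.elim (hb0 d' hface).1 (hb0 d' hface).2
  have hij : i ≠ j := by
    rintro rfl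
    have : d = d' ∨ d = D.opp d' := by
      rcases hid with h | h <;> rcases hjd with h' | h' <;> rw [h] at h'
      · exact .inl h'
      · exact .inr h'
      · exact .inr (by rw [← h', D.opp_opp])
      · exact .inl (D.opp.injective h')
    rcases this with h | h
    · exact hd h.symm
    · exact D.rot_ne d (by rw [← e2, ← h])
  rcases hij.lt_or_gt with hij | hij
  · obtain ⟨h, h'⟩ := hb.not_isOver_of_sides e2 e1 hi0 hij hj hid hjd
    exact ⟨d, rfl, iff_of_false h h'⟩
  · obtain ⟨h, h'⟩ := hb.not_isOver_of_sides e1 e2 hj0 hij hi hjd hid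
    exact ⟨d', hface, iff_of_false h h'⟩

/-! ### Discharging -/

open scoped Classical in
/-- If no triangle is on the loop or borders a triangle or a quadrilateral, and no pentagon borders
triangles along four sides, then there are too few triangles for a disc. -/
theorem MinimalGraph.exists_configuration (h : L.MinimalGraph) :
    (∃ d : δ, L.IsTriangle (D.face d) ∧ L.OnLoop d) ∨
    (∃ d : δ, L.IsTriangle (D.face d) ∧ L.IsTriangle (D.face (D.opp d)) ∧
      D.face d ≠ D.face (D.opp d)) ∨
    (∃ d : δ, L.IsQuadrilateral (D.face d) ∧ L.IsTriangle (D.face (D.opp d))) ∨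
    (∃ f : D.Face, L.IsPentagon f ∧ 4 ≤ L.numTriangleEdges f) := by
  by_contra hcon
  simp only [not_or, not_exists, not_and] at hcon
  obtain ⟨c1, c2, c3, c4⟩ := hcon
  have := Fintype.ofFinite δ
  obtain ⟨P, -, hside⟩ := L.exists_simpleLoop
  obtain ⟨S, hS, hcount⟩ := P.exists_disc D.isSingleCurve D.isPlanar
  have hmem : ∀ f, f ∈ S ↔ f ∈ L.disc := fun f => by
    obtain ⟨d, rfl⟩ := D.face_surjective f
    rw [hS, hside, face_mem_disc_iff]
  have hsides : ∀ f, D.sides f = (Finset.univ.filter fun d => D.face d = f).card := fun f => by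
    rw [sides, Nat.card_eq_fintype_card, Fintype.card_subtype]
  have htri : ∀ f, L.numTriangleEdges f =
      (Finset.univ.filter fun d => D.face d = f ∧ L.IsTriangle (D.face (D.opp d))).card := fun f => by
    rw [numTriangleEdges, Nat.card_eq_fintype_card, Fintype.card_subtype]
  have hle : ∀ f, L.numTriangleEdges f ≤ D.sides f := fun f => by
    rw [hsides, htri]
    exact Finset.card_le_card fun d => by simp +contextual
  -- Final charge at most zero, multiplied by 3: 3(4 - n), plus one for each side bordering a
  -- triangle, minus 3 for a triangle.
  have hone : ∀ f ∈ S, 12 + L.numTriangleEdges f ≤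
      3 * D.sides f + if L.IsTriangle f then 3 else 0 := by
    intro f hf
    have hd := (hmem f).1 hf
    obtain ⟨h1, h2⟩ := h f hd
    have h0 : 0 < D.sides f := by
      obtain ⟨d, rfl⟩ := D.face_surjective f
      rw [hsides]
      exact Finset.card_pos.2 ⟨d, by simp⟩
    have hle := hle f
    have hzero : (∀ d, D.face d = f → ¬ L.IsTriangle (D.face (D.opp d))) →
        L.numTriangleEdges f = 0 := fun hn => by
      rw [htri, Finset.card_eq_zero, Finset.filter_eq_empty_iff]
      exact fun d _ hd => hn d hd.1 hd.2
    by_cases h3 : D.sides f = 3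
    · have ht : L.IsTriangle f := ⟨hd, h3⟩
      have := hzero fun d hd hd' => by
        subst hd
        exact D.face_opp_ne_of_sides_eq_three h3 (not_not.1 (c2 d ht hd')).symm
      rw [if_pos ht]
      omega
    · rw [if_neg fun ht => h3 ht.2]
      by_cases h4 : D.sides f = 4
      · have := hzero fun d hd' => by
          subst hd'
          exact c3 d ⟨hd, h4⟩
        omega
      · by_cases h5 : D.sides f = 5
        · have := c4 f ⟨hd, h5⟩
          omega
        · omega
  have hsum := Finset.sum_le_sum hone
  rw [Finset.sum_add_distrib, Finset.sum_add_distrib, ← Finset.mul_sum, Finset.sum_const,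
    smul_eq_mul] at hsum
  have hD : ∑ f ∈ S, D.sides f = (Finset.univ.filter fun d => D.face d ∈ S).card := by
    rw [Finset.card_eq_sum_card_fiberwise (f := D.face) (t := S) (by intro d; simp)]
    refine Finset.sum_congr rfl fun f hf => ?_
    rw [hsides, Finset.filter_filter]
    congr 1
    ext d
    simp only [Finset.mem_filter, Finset.mem_univ, true_and]
    exact ⟨fun h => ⟨h ▸ hf, h⟩, fun h => h.2⟩
  -- Charge received equals charge sent: no side of a triangle is on the loop, so the face across it
  -- is again in the disc.
  have hT : ∑ f ∈ S, L.numTriangleEdges f = ∑ f ∈ S, if L.IsTriangle f then 3 else 0 := by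
    calc ∑ f ∈ S, L.numTriangleEdges f
        = (Finset.univ.filter fun d => L.IsTriangle (D.face (D.opp d))).card := by
          rw [Finset.card_eq_sum_card_fiberwise (f := D.face) (t := S)]
          · refine Finset.sum_congr rfl fun f hf => ?_
            rw [htri, Finset.filter_filter]
            simp only [and_comm]
          · intro d hd
            have ht : L.IsTriangle (D.face (D.opp d)) := by simpa using hd
            have hn := c1 _ ht
            have h1 := LeftInDisc.across _ (face_mem_disc_iff.1 ht.1) hn
            rw [D.opp_opp] at h1
            exact (hmem _).2 (face_mem_disc_iff.2 h1)
      _ = (Finset.univ.filter fun d => L.IsTriangle (D.face d)).card :=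
          Finset.card_equiv D.opp (by simp)
      _ = ∑ f ∈ S, if L.IsTriangle f then 3 else 0 := by
          rw [Finset.card_eq_sum_card_fiberwise (f := D.face) (t := S)]
          · refine Finset.sum_congr rfl fun f hf => ?_
            rw [Finset.filter_filter]
            split_ifs with ht
            · rw [← ht.2, hsides]
              congr 1
              ext d
              simp only [Finset.mem_filter, Finset.mem_univ, true_and]
              exact ⟨fun h => h.2, fun h => ⟨h ▸ ht, h⟩⟩
            · rw [Finset.card_eq_zero, Finset.filter_eq_empty_iff]
              exact fun d _ hd => ht (hd.2 ▸ hd.1)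
          · intro d hd
            have ht : L.IsTriangle (D.face d) := by simpa using hd
            exact (hmem _).2 ht.1
  -- The received and sent charges cancel, leaving 12|S| ≤ 3I for the total number I of sides,
  -- against I + 3 ≤ 4|S|.
  omega

end LoopTangle

end KnotDiagram

theorem proposition5p8 {δ : Type*} [Finite δ] (D : KnotDiagram δ) (L : D.LoopTangle)
    (hL : L.MinimalAscending ∨ L.MinimalGraph) :
    (∃ d : δ, L.IsTriangle (D.face d) ∧ L.OnLoop d) ∨
    (∃ d : δ, L.IsTriangle (D.face d) ∧ L.IsTriangle (D.face (D.opp d)) ∧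
      D.face d ≠ D.face (D.opp d)) ∨
    (∃ d : δ, L.IsQuadrilateral (D.face d) ∧ L.IsTriangle (D.face (D.opp d))) ∨
    (∃ f : D.Face, L.IsPentagon f ∧ 4 ≤ L.numTriangleEdges f) :=
  (hL.elim KnotDiagram.LoopTangle.MinimalAscending.minimalGraph id).exists_configuration
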